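/- Let $k$ be a field, let $T$ be an affine domain over $k$ (a finitely generated $k$-algebra that is an integral domain), and let $R$ be a $k$-subalgebra of $T$. For a domain $A$ that is a $k$-algebra, let $\operatorname{t.d.}(A)$ denote the transcendence degree over $k$ of the field of fractions of $A$, let $\dim A$ denote the Krull dimension of $A$, and let $\dim_v A$ denote its valuative dimension, i.e. the supremum of the Krull dimensions of the valuation rings $V$ with $A\subseteq V\subseteq \operatorname{Frac}(A)$ and $\operatorname{Frac}(V)=\operatorname{Frac}(A)$. Then: (1) $\dim R=\operatorname{t.d.}(R)$, and $R$ is a Jaffard domain, that is, $\dim R<\infty$ and $\dim R[X_1,\dots,X_n]=n+\dim R$ for all $n\ge 1$; moreover $\dim R=\dim_v R$. (2) For every prime ideal $P$ of $T$, $\dim R=\operatorname{ht}(P\cap R)+\operatorname{t.d.}\bigl(R/(P\cap R)\bigr)$. In particular, $\dim R=\operatorname{ht}(M)$ for every maximal ideal $M$ of $R$ that survives in $T$, i.e. such that $MT\neq T$. -/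

import Mathlib

/-- The transcendence degree over a field `k` of a domain `A` that is a `k`-algebra: the
transcendence degree over `k` of the field of fractions of `A`. -/
noncomputable def tdeg (k A : Type*) [Field k] [CommRing A] [IsDomain A] [Algebra k A] : ℕ∞ :=
  Cardinal.toENat (Algebra.trdeg k (FractionRing A))

/-- The valuation overrings of a domain `A`: the valuation rings of the field of fractions of `A`
that contain `A` (the field of fractions itself is one of them). -/
def valuationOverrings (A : Type*) [CommRing A] [IsDomain A] :
    Set (ValuationSubring (FractionRing A)) :=
  {V | ∀ a : A, algebraMap A (FractionRing A) a ∈ V}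

/-- The valuative dimension of a domain: the supremum of the Krull dimensions of its valuation
overrings. -/
noncomputable def valuativeDim (A : Type*) [CommRing A] [IsDomain A] : WithBot ℕ∞ :=
  ⨆ V ∈ valuationOverrings A, ringKrullDim V

/-- A domain `A` is Jaffard if it has finite Krull dimension and
`dim A[X₁, …, Xₙ] = n + dim A` for all `n ≥ 1`. -/
def IsJaffard (A : Type*) [CommRing A] [IsDomain A] : Prop :=
  FiniteRingKrullDim A ∧
    ∀ n : ℕ, 1 ≤ n → ringKrullDim (MvPolynomial (Fin n) A) = n + ringKrullDim A

/-- An ideal `I` of `A` survives in the `A`-algebra `B` if `IB ≠ B`. -/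
def SurvivesIn {A : Type*} [CommRing A] (I : Ideal A) (B : Type*) [CommRing B] [Algebra A B] :
    Prop :=
  I.map (algebraMap A B) ≠ ⊤

/-! ### Transcendence degree of domains over a field. -/

section TranscendenceDegree

variable {k A B : Type*} [Field k] [CommRing A] [IsDomain A] [Algebra k A]

/-! Everything follows from ht(P ∩ R) + t.d.(R/(P ∩ R)) = t.d.(R) for primes P of T. For "≤", t.d.
drops strictly along a chain of primes of any domain over k (`height_add_tdeg_quotient_le`). For "≥"
(`tdeg_le_height_under_add_tdeg_quotient`), induct on ht(P ∩ R): enlarge P until T/P is algebraic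
over R/(P ∩ R), then descend in T to a smaller prime Q with t.d.(T/Q) ≤ t.d.(T/P) + 1 and Q ∩ R ≠ P
∩ R; the bound on t.d. is a principal ideal theorem for affine domains.

A maximal P has T/P finite over k, so dim R = ht(P ∩ R) = t.d.(R), and a surviving maximal ideal of
R is such a contraction. R[X₁, …, Xₙ] lies in the affine domain T[X₁, …, Xₙ], whence Jaffard.
Finally dim R ≤ dim_v R ≤ t.d.(R), by lifting chains of primes to valuation rings and applying the
upper bound to each valuation overring. -/

theorem tdeg_eq_toENat_trdeg : tdeg k A = Cardinal.toENat (Algebra.trdeg k A) := by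
  have := IsLocalization.isAlgebraic (S := FractionRing A) (nonZeroDivisors A)
  have h := trdeg_add_eq (R := k) (S := A) (A := FractionRing A)
  rw [trdeg_eq_zero (R := A) (A := FractionRing A), add_zero] at h
  rw [tdeg, h]

theorem tdeg_ne_top_of_finiteType [Algebra.FiniteType k A] : tdeg k A ≠ ⊤ := by
  rw [tdeg_eq_toENat_trdeg, ne_eq, Cardinal.toENat_eq_top, not_le]
  exact trdeg_lt_aleph0_of_finiteType

theorem exists_isTranscendenceBasis_fin_of_tdeg_eq {n : ℕ} (h : tdeg k A = n) :
    ∃ x : Fin n → A, IsTranscendenceBasis k x := by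
  obtain ⟨s, hs⟩ := exists_isTranscendenceBasis k A
  have h1 := hs.cardinalMk_eq_trdeg
  rw [tdeg_eq_toENat_trdeg, ← h1] at h
  have h2 : Cardinal.mk s = n := Cardinal.toENat_eq_natCast.mp h
  have e : Nonempty (s ≃ Fin n) := by
    rw [← Cardinal.lift_mk_eq']
    simp [h2]
  obtain ⟨e⟩ := e
  exact ⟨_, hs.comp_equiv e.symm⟩

theorem le_tdeg_of_algebraicIndependent {ι : Type*} [Finite ι] {x : ι → A}
    (hx : AlgebraicIndependent k x) : (Nat.card ι : ℕ∞) ≤ tdeg k A := by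
  rw [tdeg_eq_toENat_trdeg]
  have h := Cardinal.toENat.monotone' hx.lift_cardinalMk_le_trdeg
  have h2 : Cardinal.mk ι = Nat.card ι := (Cardinal.mk_eq_nat_iff.mpr ⟨Finite.equivFin ι⟩)
  rw [h2] at h
  simpa using h

variable [CommRing B] [IsDomain B] [Algebra k B]

theorem tdeg_le_of_injective (f : A →ₐ[k] B) (hf : Function.Injective f) :
    tdeg k A ≤ tdeg k B := by
  rw [tdeg_eq_toENat_trdeg, tdeg_eq_toENat_trdeg, ← Cardinal.toENat_lift,
    ← Cardinal.toENat_lift (c := Algebra.trdeg k B)]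
  exact Cardinal.toENat.monotone' (lift_trdeg_le_of_injective f hf)

theorem tdeg_le_of_surjective (f : A →ₐ[k] B) (hf : Function.Surjective f) :
    tdeg k B ≤ tdeg k A := by
  rw [tdeg_eq_toENat_trdeg, tdeg_eq_toENat_trdeg, ← Cardinal.toENat_lift,
    ← Cardinal.toENat_lift (c := Algebra.trdeg k A)]
  exact Cardinal.toENat.monotone' (lift_trdeg_le_of_surjective f hf)

theorem AlgEquiv.tdeg_eq (e : A ≃ₐ[k] B) : tdeg k A = tdeg k B :=
  le_antisymm (tdeg_le_of_injective e.toAlgHom e.injective)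
    (tdeg_le_of_injective e.symm.toAlgHom e.symm.injective)

theorem tdeg_eq_of_isAlgebraic [Algebra A B] [IsScalarTower k A B] [FaithfulSMul A B]
    [Algebra.IsAlgebraic A B] : tdeg k B = tdeg k A := by
  have h := congrArg Cardinal.toENat (lift_trdeg_add_eq (R := k) (S := A) (A := B))
  rw [trdeg_eq_zero (R := A) (A := B)] at h
  rw [tdeg_eq_toENat_trdeg, tdeg_eq_toENat_trdeg]
  simpa using h.symm

/-- If the degrees agreed and were finite, a transcendence basis of `B` would lift to one of `A`. A
nonzero element of the kernel is algebraic over the polynomial ring on the lifts, so the kernel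
meets that ring nontrivially: a relation in `B`. -/
theorem tdeg_add_one_le_of_surjective (f : A →ₐ[k] B) (hf : Function.Surjective f)
    (hker : RingHom.ker f ≠ ⊥) : tdeg k B + 1 ≤ tdeg k A := by
  cases hA : tdeg k A with
  | top => exact le_top
  | coe n =>
    refine Order.add_one_le_of_lt (lt_of_le_of_ne (hA ▸ tdeg_le_of_surjective f hf) fun hB => ?_)
    obtain ⟨x, hx⟩ := exists_isTranscendenceBasis_fin_of_tdeg_eq hB
    choose y hy using fun i => hf (x i)
    have hyx : f ∘ y = x := funext hy
    have hyi : AlgebraicIndependent k y := .of_comp f (hyx ▸ hx.1)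
    have hyb : IsTranscendenceBasis k y := by
      refine hyi.isTranscendenceBasis_of_lift_trdeg_le_of_finite ?_
      rw [tdeg_eq_toENat_trdeg] at hA
      rw [Cardinal.toENat_eq_natCast.mp hA]
      simp
    have := hyb.isAlgebraic
    obtain ⟨z, hz, hz0⟩ := Submodule.exists_mem_ne_zero_of_ne_bot hker
    obtain ⟨⟨b, hbA⟩, hb, hb0⟩ := Submodule.exists_mem_ne_zero_of_ne_bot
      (Ideal.comap_ne_bot_of_algebraic_mem hz0 hz
        (Algebra.IsAlgebraic.isAlgebraic (R := Algebra.adjoin k (Set.range y)) z))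
    rw [Algebra.adjoin_range_eq_range_aeval] at hbA
    obtain ⟨p, rfl⟩ := hbA
    have hp : MvPolynomial.aeval x p = 0 := by
      rw [← hyx]
      exact (MvPolynomial.comp_aeval_apply y f p).symm.trans hb
    obtain rfl : p = 0 := hx.1 (hp.trans (map_zero _).symm)
    exact hb0 (Subtype.ext (map_zero (MvPolynomial.aeval y)))

end TranscendenceDegree

/-! ### Upper bounds by transcendence degree. -/

section DimensionInequality

variable {k R : Type*} [Field k] [CommRing R] [IsDomain R] [Algebra k R]

theorem tdeg_quotient_add_one_le_of_lt {k R : Type*} [Field k] [CommRing R] [Algebra k R]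
    {p q : Ideal R} [p.IsPrime] [q.IsPrime] (h : p < q) :
    tdeg k (R ⧸ q) + 1 ≤ tdeg k (R ⧸ p) := by
  refine tdeg_add_one_le_of_surjective (Ideal.Quotient.factorₐ k h.le)
    (Ideal.Quotient.factor_surjective h.le) ?_
  obtain ⟨x, hxq, hxp⟩ := SetLike.exists_of_lt h
  refine Submodule.ne_bot_iff _ |>.mpr ⟨Ideal.Quotient.mk p x, ?_, ?_⟩
  · simpa [RingHom.mem_ker] using Ideal.Quotient.eq_zero_iff_mem.mpr hxq
  · rwa [ne_eq, Ideal.Quotient.eq_zero_iff_mem]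

theorem tdeg_quotient_le (p : Ideal R) [p.IsPrime] : tdeg k (R ⧸ p) ≤ tdeg k R :=
  tdeg_le_of_surjective (Ideal.Quotient.mkₐ k p) (Ideal.Quotient.mkₐ_surjective k p)

theorem height_add_tdeg_quotient_le (p : Ideal R) [p.IsPrime] :
    p.height + tdeg k (R ⧸ p) ≤ tdeg k R := by
  cases hR : tdeg k R with
  | top => exact le_top
  | coe N =>
    have hfin (q : PrimeSpectrum R) : ∃ n : ℕ, tdeg k (R ⧸ q.asIdeal) = n ∧ n ≤ N := by
      have h := tdeg_quotient_le (k := k) q.asIdeal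
      rw [hR] at h
      obtain ⟨n, hn⟩ := ENat.ne_top_iff_exists.mp (ne_top_of_le_ne_top (ENat.natCast_ne_top N) h)
      exact ⟨n, hn.symm, by rw [← hn] at h; exact_mod_cast h⟩
    choose t ht htN using hfin
    -- The codimension in t.d. strictly increases with the prime, so it bounds the height; `htN`
    -- makes the truncated subtraction exact.
    have hmono : StrictMono fun q => N - t q := fun q q' hqq' => by
      have h := tdeg_quotient_add_one_le_of_lt (k := k) ((PrimeSpectrum.asIdeal_lt_asIdeal _ _).2 hqq')
      rw [ht, ht] at h
      have h' : t q' + 1 ≤ t q := by exact_mod_cast h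
      have := htN q
      dsimp only
      omega
    have h := Order.height_le_height_apply_of_strictMono _ hmono ⟨p, inferInstance⟩
    rw [Order.height_nat, ← PrimeSpectrum.height_eq_orderHeight] at h
    calc p.height + tdeg k (R ⧸ p) ≤ ((N - t ⟨p, inferInstance⟩ : ℕ) : ℕ∞) + t ⟨p, inferInstance⟩ :=
          add_le_add h (ht ⟨p, inferInstance⟩).le
      _ = N := by exact_mod_cast Nat.sub_add_cancel (htN _)

theorem height_le_tdeg (p : Ideal R) [p.IsPrime] : p.height ≤ tdeg k R :=
  le_self_add.trans (height_add_tdeg_quotient_le p)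

theorem ringKrullDim_le_tdeg : ringKrullDim R ≤ (tdeg k R : WithBot ℕ∞) :=
  (ringKrullDim_le_iff_height_le _).mpr fun p _ => WithBot.coe_le_coe.mpr (height_le_tdeg p)

end DimensionInequality

/-! ### Principal ideal theorem for transcendence degree. -/

section PrincipalIdeal

open IntermediateField in
-- Take norms from K(y) to K in g = y·c: y has norm ± the constant coefficient, g has norm a power
-- of g, and c = g/y lies in K(y) and is integral, so its norm lies in `B`.
theorem minpoly_coeff_zero_dvd_pow_finrank {B C : Type*} (K L : Type*) [CommRing B] [IsDomain B]
    [IsIntegrallyClosed B] [CommRing C] [IsDomain C] [Algebra B C] [Algebra.IsIntegral B C]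
    [Field K] [Algebra B K] [IsFractionRing B K] [Field L] [Algebra K L] [Algebra B L]
    [IsScalarTower B K L] [Algebra C L] [IsScalarTower B C L] [FaithfulSMul C L]
    {y c : C} (hy : y ≠ 0) {g : B} (hg : algebraMap B C g = y * c) :
    (minpoly B y).coeff 0 ∣ g ^ Module.finrank K K⟮algebraMap C L y⟯ := by
  let z := algebraMap C L y
  have hz0 : z ≠ 0 := by simpa [z] using hy
  have hzB : IsIntegral B z := (Algebra.IsIntegral.isIntegral (R := B) y).algebraMap
  have hz : IsIntegral K z := hzB.tower_top
  have : IsScalarTower B K⟮z⟯ L := .of_algebraMap_eq fun x => by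
    rw [IsScalarTower.algebraMap_apply B K K⟮z⟯, ← IsScalarTower.algebraMap_apply K K⟮z⟯ L,
      ← IsScalarTower.algebraMap_apply B K L]
  let e : K⟮z⟯ := AdjoinSimple.gen K z
  have he : algebraMap K⟮z⟯ L e = z := AdjoinSimple.algebraMap_gen K z
  have he0 : e ≠ 0 := fun h => hz0 (by rw [← he, h, map_zero])
  let d : K⟮z⟯ := algebraMap B K⟮z⟯ g / e
  have hd : algebraMap K⟮z⟯ L d = algebraMap C L c := by
    rw [map_div₀, he, ← IsScalarTower.algebraMap_apply, IsScalarTower.algebraMap_apply B C L, hg,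
      map_mul]
    exact mul_div_cancel_left₀ _ hz0
  have hdB : IsIntegral B d := by
    rw [← isIntegral_algebraMap_iff (algebraMap K⟮z⟯ L).injective, hd]
    exact (Algebra.IsIntegral.isIntegral (R := B) c).algebraMap
  have : FiniteDimensional K K⟮z⟯ := adjoin.finiteDimensional hz
  obtain ⟨b, hb⟩ := IsIntegrallyClosed.isIntegral_iff.mp (Algebra.isIntegral_norm K hdB)
  have hNe : Algebra.norm K e = algebraMap B K
      ((-1) ^ (adjoin.powerBasis hz).dim * (minpoly B y).coeff 0) := by
    have h := Algebra.PowerBasis.norm_gen_eq_coeff_zero_minpoly (adjoin.powerBasis hz)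
    rw [adjoin.powerBasis_gen] at h
    rw [h, minpoly_gen, minpoly.isIntegrallyClosed_eq_field_fractions (R := B) K L
      (Algebra.IsIntegral.isIntegral y)]
    simp
  have hmul : Algebra.norm K e * Algebra.norm K d = algebraMap B K g ^ Module.finrank K K⟮z⟯ := by
    rw [← map_mul, mul_div_cancel₀ _ he0, IsScalarTower.algebraMap_apply B K K⟮z⟯,
      Algebra.norm_algebraMap]
  rw [hNe, ← hb, ← map_mul, ← map_pow] at hmul
  change _ ∣ g ^ Module.finrank K K⟮z⟯
  rw [← IsFractionRing.injective B K hmul]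
  exact ⟨(-1) ^ (adjoin.powerBasis hz).dim * b, by ring⟩

theorem MvPolynomial.eq_zero_of_dvd_rename_pow {σ k : Type*} [Field k] {f : MvPolynomial σ k}
    {j : σ} (hj : j ∈ f.vars) {p : MvPolynomial {i // i ≠ j} k} {n : ℕ}
    (h : f ∣ rename Subtype.val p ^ n) : p = 0 := by
  classical
  by_contra hp
  have hp' : rename Subtype.val p ≠ 0 :=
    fun h0 => hp (rename_injective _ Subtype.val_injective (h0.trans (map_zero _).symm))
  obtain ⟨g, hg⟩ := h
  have hfg : f * g ≠ 0 := hg ▸ pow_ne_zero n hp'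
  have hdeg := congrArg (degreeOf j) hg
  rw [degreeOf_pow_eq _ _ _ hp', degreeOf_mul_eq (left_ne_zero_of_mul hfg)
    (right_ne_zero_of_mul hfg)] at hdeg
  have h0 : degreeOf j (rename Subtype.val p) = 0 := by
    by_contra hmem
    obtain ⟨i, -, hi⟩ := Finset.mem_image.mp (vars_rename _ _ (mem_vars_iff_degreeOf_ne_zero.mpr hmem))
    exact i.2 hi
  have h1 : degreeOf j f ≠ 0 := mem_vars_iff_degreeOf_ne_zero.mp hj
  rw [h0] at hdeg
  omega

/-- By Noether normalization `C` is integral over a polynomial ring in s = t.d.(C) variables. The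
constant coefficient f of the minimal polynomial of y lies in P, so it involves some variable X_j.
The other s − 1 variables stay independent modulo P: a relation p has a power divisible by y, so f
divides a power of p by norms, while p omits X_j. -/
theorem tdeg_le_tdeg_quotient_add_one_of_le_radical {k C : Type*} [Field k] [CommRing C]
    [IsDomain C] [Algebra k C] [Algebra.FiniteType k C] {y : C} (hy : y ≠ 0) {P : Ideal C}
    [P.IsPrime] (hyP : y ∈ P) (hP : P ≤ (Ideal.span {y}).radical) :
    tdeg k C ≤ tdeg k (C ⧸ P) + 1 := by
  obtain ⟨s, φ, hφ, hint⟩ := exists_integral_inj_algHom_of_fg k C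
  let _ : Algebra (MvPolynomial (Fin s) k) C := φ.toRingHom.toAlgebra
  have : FaithfulSMul (MvPolynomial (Fin s) k) C :=
    (faithfulSMul_iff_algebraMap_injective _ _).mpr hφ
  have : IsScalarTower k (MvPolynomial (Fin s) k) C := .of_algebraMap_eq fun x => (φ.commutes x).symm
  have : Algebra.IsIntegral (MvPolynomial (Fin s) k) C := ⟨hint⟩
  have hs : tdeg k C = s := by
    rw [tdeg_eq_of_isAlgebraic (A := MvPolynomial (Fin s) k), tdeg_eq_toENat_trdeg,
      MvPolynomial.trdeg_of_isDomain]
    simp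
  let f : MvPolynomial (Fin s) k := (minpoly (MvPolynomial (Fin s) k) y).coeff 0
  have hyint := Algebra.IsIntegral.isIntegral (R := MvPolynomial (Fin s) k) y
  let _ : Algebra (FractionRing (MvPolynomial (Fin s) k)) (FractionRing C) :=
    FractionRing.liftAlgebra _ _
  have : IsScalarTower (MvPolynomial (Fin s) k) (FractionRing (MvPolynomial (Fin s) k))
    (FractionRing C) := FractionRing.isScalarTower_liftAlgebra _ _
  have hf0 : f ≠ 0 := fun h => by
    refine minpoly.coeff_zero_ne_zero (A := FractionRing (MvPolynomial (Fin s) k))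
      (x := algebraMap C (FractionRing C) y) hyint.algebraMap.tower_top (by simpa using hy) ?_
    rw [minpoly.isIntegrallyClosed_eq_field_fractions (R := MvPolynomial (Fin s) k)
      _ (FractionRing C) hyint, Polynomial.coeff_map]
    exact (congrArg _ h).trans (map_zero _)
  have hfP : φ f ∈ P := by
    have h := minpoly.aeval (MvPolynomial (Fin s) k) y
    rw [← Polynomial.divX_mul_X_add (minpoly (MvPolynomial (Fin s) k) y), map_add, map_mul,
      Polynomial.aeval_X, Polynomial.aeval_C] at h
    rw [show φ f = _ from eq_neg_of_add_eq_zero_right h]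
    exact P.neg_mem (P.mul_mem_left _ hyP)
  obtain ⟨j, hj⟩ : f.vars.Nonempty := by
    rw [Finset.nonempty_iff_ne_empty]
    intro h
    rw [MvPolynomial.vars_eq_empty_iff_eq_C] at h
    have ha : f.coeff 0 ≠ 0 := fun h0 => hf0 (by rw [h, h0, map_zero])
    refine ‹P.IsPrime›.ne_top (P.eq_top_of_isUnit_mem hfP ?_)
    rw [h]
    exact ((IsUnit.mk0 _ ha).map MvPolynomial.C).map φ
  have hind : AlgebraicIndependent k
      fun i : {i // i ≠ j} => Ideal.Quotient.mkₐ k P (φ (MvPolynomial.X i.1)) := by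
    rw [algebraicIndependent_iff]
    intro p hp
    have hp' : φ (MvPolynomial.rename Subtype.val p) ∈ P := by
      rw [← Ideal.Quotient.eq_zero_iff_mem, ← hp, ← Ideal.Quotient.mkₐ_eq_mk k]
      change ((Ideal.Quotient.mkₐ k P).comp (φ.comp (MvPolynomial.rename Subtype.val))) p = _
      congr 1
      ext i
      simp
    obtain ⟨n, hn⟩ := hP hp'
    obtain ⟨c, hc⟩ := Ideal.mem_span_singleton.mp hn
    have hm := minpoly_coeff_zero_dvd_pow_finrank (FractionRing (MvPolynomial (Fin s) k))
      (FractionRing C) hy (g := MvPolynomial.rename Subtype.val p ^ n) ((map_pow φ _ _).trans hc)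
    rw [← pow_mul] at hm
    exact MvPolynomial.eq_zero_of_dvd_rename_pow hj hm
  have hcard := le_tdeg_of_algebraicIndependent hind
  rw [hs]
  refine le_trans ?_ (add_le_add_left hcard 1)
  rw [Nat.card_eq_fintype_card, Fintype.card_subtype_compl, Fintype.card_fin,
    Fintype.card_unique]
  exact_mod_cast le_tsub_add

theorem isAlgebraic_quotient_of_isLocalization {A C : Type*} [CommRing A] [CommRing C] [Algebra A C]
    (S : Submonoid A) [IsLocalization S C] (P : Ideal A) (P' : Ideal C) [P.IsPrime]
    [P'.LiesOver P] (hS : Disjoint (S : Set A) P) : Algebra.IsAlgebraic (A ⧸ P) (C ⧸ P') := by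
  refine ⟨fun x => ?_⟩
  obtain ⟨c, rfl⟩ := Ideal.Quotient.mk_surjective x
  obtain ⟨a, s, rfl⟩ := IsLocalization.exists_mk'_eq S c
  have hs : Ideal.Quotient.mk P (s : A) ≠ 0 := fun h =>
    Set.disjoint_left.mp hS s.2 (Ideal.Quotient.eq_zero_iff_mem.mp h)
  refine ⟨.C (Ideal.Quotient.mk P (s : A)) * .X - .C (Ideal.Quotient.mk P a), fun h0 => hs ?_, ?_⟩
  · simpa using congrArg (Polynomial.coeff · 1) h0
  · simp only [map_sub, map_mul, Polynomial.aeval_C, Polynomial.aeval_X,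
      Ideal.Quotient.algebraMap_mk_of_liesOver]
    rw [← map_mul, ← map_sub, IsLocalization.mk'_spec', sub_self, map_zero]

/-- Inverting an h outside P but in every other minimal prime of (y) makes P the radical of (y), and
changes neither transcendence degree. -/
theorem tdeg_le_tdeg_quotient_add_one_of_mem_minimalPrimes {k A : Type*} [Field k] [CommRing A]
    [IsDomain A] [Algebra k A] [Algebra.FiniteType k A] {y : A} (hy : y ≠ 0) {P : Ideal A}
    [P.IsPrime] (hP : P ∈ (Ideal.span {y}).minimalPrimes) :
    tdeg k A ≤ tdeg k (A ⧸ P) + 1 := by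
  classical
  have : IsNoetherianRing A := Algebra.FiniteType.isNoetherianRing k A
  obtain ⟨h, hhP, hh⟩ : ∃ h ∉ P, ∀ Q ∈ (Ideal.span {y}).minimalPrimes, Q ≠ P → h ∈ Q := by
    have hfin := (Ideal.span {y}).finite_minimalPrimes_of_isNoetherianRing A
    have hle : ¬ (hfin.toFinset.erase P).inf id ≤ P := by
      rw [‹P.IsPrime›.inf_le']
      rintro ⟨Q, hQ, hQP⟩
      rw [Finset.mem_erase, hfin.mem_toFinset] at hQ
      exact hQ.1 (le_antisymm hQP (hP.2 hQ.2.1 hQP))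
    obtain ⟨h, hmem, hhP⟩ := SetLike.not_le_iff_exists.mp hle
    refine ⟨h, hhP, fun Q hQ hQP => ?_⟩
    exact (Finset.inf_le (f := id) (Finset.mem_erase.mpr ⟨hQP, hfin.mem_toFinset.mpr hQ⟩)) hmem
  have hh0 : h ≠ 0 := fun h0 => hhP (h0 ▸ P.zero_mem)
  let C := Localization.Away h
  have hpow : Submonoid.powers h ≤ nonZeroDivisors A := powers_le_nonZeroDivisors_of_noZeroDivisors hh0
  have : IsDomain C := IsLocalization.isDomain_localization hpow
  have : FaithfulSMul A C :=
    (faithfulSMul_iff_algebraMap_injective _ _).mpr (IsLocalization.injective C hpow)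
  have : Algebra.FiniteType A C := inferInstance
  have : Algebra.FiniteType k C := Algebra.FiniteType.trans (S := A) ‹_› ‹_›
  have hdisj : Disjoint (Submonoid.powers h : Set A) P :=
    (Ideal.disjoint_powers_iff_notMem h ‹P.IsPrime›.isRadical).mpr hhP
  let P' : Ideal C := P.map (algebraMap A C)
  have : P'.IsPrime := IsLocalization.isPrime_of_isPrime_disjoint (Submonoid.powers h) C P ‹_› hdisj
  have : P'.LiesOver P :=
    ⟨(IsLocalization.under_map_of_isPrime_disjoint (Submonoid.powers h) C ‹_› hdisj).symm⟩
  have : Algebra.IsAlgebraic A C := IsLocalization.isAlgebraic (S := C) (Submonoid.powers h)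
  have := isAlgebraic_quotient_of_isLocalization (Submonoid.powers h) P P' hdisj
  have hyP : y ∈ P := hP.1.2 (Ideal.mem_span_singleton_self y)
  rw [← tdeg_eq_of_isAlgebraic (A := A) (B := C), ← tdeg_eq_of_isAlgebraic (A := A ⧸ P) (B := C ⧸ P')]
  refine tdeg_le_tdeg_quotient_add_one_of_le_radical (y := algebraMap A C y) (by simpa using hy)
    (Ideal.mem_map_of_mem _ hyP) ?_
  rw [Ideal.radical_eq_sInf, Ideal.map_le_iff_le_comap]
  refine fun x hx => Ideal.mem_sInf.mpr fun {J} ⟨hJ, hJprime⟩ => ?_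
  have hyJ : Ideal.span {y} ≤ J.comap (algebraMap A C) := by
    rwa [Ideal.span_singleton_le_iff_mem, Ideal.mem_comap, ← Ideal.span_singleton_le_iff_mem]
  obtain ⟨Q, hQ, hQJ⟩ := Ideal.exists_minimalPrimes_le hyJ
  by_cases hQP : Q = P
  · exact hQJ (hQP ▸ hx)
  · refine absurd (J.eq_top_of_isUnit_mem (hQJ (hh Q hQ hQP)) ?_) hJprime.ne_top
    exact IsLocalization.Away.algebraMap_isUnit h

end PrincipalIdeal

/-! ### Lower bound for heights of contracted primes. -/

section LowerBound

/-- Otherwise prime avoidance gives x in P outside all minimal primes of (y). A prime Q ≤ P minimal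
over x has height at most 1 and contains y, yet lies strictly above a nonzero minimal prime of (y).
-/
theorem mem_minimalPrimes_span_singleton_of_forall_mem {A : Type*} [CommRing A] [IsDomain A]
    [IsNoetherianRing A] {y : A} {P : Ideal A} [P.IsPrime] (hyP : y ∈ P)
    (h : ∀ Q : Ideal A, Q.IsPrime → Q ≤ P → Q ≠ ⊥ → y ∈ Q) :
    y = 0 ∨ P ∈ (Ideal.span {y}).minimalPrimes := by
  rw [or_iff_not_imp_left]
  intro hy
  by_contra hP
  have hle : Ideal.span {y} ≤ P := (Ideal.span_singleton_le_iff_mem P).mpr hyP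
  have hfin := (Ideal.span {y}).finite_minimalPrimes_of_isNoetherianRing A
  have hsub : ¬ (P : Set A) ⊆ ⋃ Q ∈ (Ideal.span {y}).minimalPrimes, ((id Q : Ideal A) : Set A) := by
    rw [Ideal.subset_union_prime_finite hfin (f := id) ⊥ ⊥ fun Q hQ _ _ => hQ.isPrime]
    rintro ⟨Q, hQ, hPQ⟩
    exact hP (le_antisymm hPQ (hQ.2 ⟨‹_›, hle⟩ hPQ) ▸ hQ)
  obtain ⟨x, hxP, hx⟩ := Set.not_subset.mp hsub
  simp only [id, Set.mem_iUnion, not_exists] at hx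
  obtain ⟨Q, hQ, hQP⟩ := Ideal.exists_minimalPrimes_le
    ((Ideal.span_singleton_le_iff_mem P).mpr hxP)
  have := hQ.isPrime
  have hxQ : x ∈ Q := hQ.1.2 (Ideal.mem_span_singleton_self x)
  have hQ0 : Q ≠ ⊥ := by
    rintro rfl
    obtain ⟨Q', hQ', -⟩ := Ideal.exists_minimalPrimes_le hle
    exact hx Q' hQ' ((Ideal.mem_bot.mp hxQ) ▸ Q'.zero_mem)
  obtain ⟨Q', hQ', hQQ'⟩ := Ideal.exists_minimalPrimes_le
    ((Ideal.span_singleton_le_iff_mem Q).mpr (h Q ‹_› hQP hQ0))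
  have := hQ'.isPrime
  have hQ'0 : Q' ≠ ⊥ := by
    rintro rfl
    exact hy (by simpa using hQ'.1.2 (Ideal.mem_span_singleton_self y))
  rcases hQQ'.eq_or_lt with rfl | hlt
  · exact hx Q' hQ' hxQ
  · have h1 := Ideal.height_le_one_of_isPrincipal_of_mem_minimalPrimes _ Q hQ
    have h2 := (add_le_add_left (Ideal.height_add_one_le_of_lt_of_isPrime
      (bot_lt_iff_ne_bot.mpr hQ'0)) 1).trans (Ideal.height_add_one_le_of_lt_of_isPrime hlt)
    rw [Ideal.height_bot] at h2
    exact absurd (h2.trans h1) (by decide)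

theorem exists_isPrime_le_notMem_tdeg_quotient_le {k T : Type*} [Field k] [CommRing T] [IsDomain T]
    [Algebra k T] [Algebra.FiniteType k T] {y : T} (hy : y ≠ 0) (P : Ideal T) [P.IsPrime]
    (hyP : y ∈ P) :
    ∃ (Q : Ideal T) (_ : Q.IsPrime), Q ≤ P ∧ y ∉ Q ∧ tdeg k (T ⧸ Q) ≤ tdeg k (T ⧸ P) + 1 := by
  have : IsNoetherianRing T := Algebra.FiniteType.isNoetherianRing k T
  -- By maximality of Q, every nonzero prime of T/Q inside P/Q contains y, so P/Q is minimal over y.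
  obtain ⟨Q, ⟨hQ, hQP, hyQ⟩, hmax⟩ := set_has_maximal_iff_noetherian.mpr ‹IsNoetherianRing T›
    {Q : Ideal T | Q.IsPrime ∧ Q ≤ P ∧ y ∉ Q} ⟨⊥, Ideal.isPrime_bot, bot_le, by simpa using hy⟩
  refine ⟨Q, hQ, hQP, hyQ, ?_⟩
  let f := Ideal.Quotient.mk Q
  have hf : Function.Surjective f := Ideal.Quotient.mk_surjective
  have hker : RingHom.ker f ≤ P := by rwa [Ideal.mk_ker]
  have : (P.map f).IsPrime := Ideal.map_isPrime_of_surjective hf hker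
  have hcomap : (P.map f).comap f = P := by
    rw [Ideal.comap_map_of_surjective' f hf, sup_eq_left.mpr hker]
  have hy0 : f y ≠ 0 := fun h => hyQ (Ideal.Quotient.eq_zero_iff_mem.mp h)
  have hmin := (mem_minimalPrimes_span_singleton_of_forall_mem (y := f y) (P := P.map f)
    (Ideal.mem_map_of_mem f hyP) fun J hJ hJP hJ0 => by
      by_contra hyJ
      have hlt : Q < J.comap f := by
        refine lt_of_le_of_ne (fun x hx => ?_) fun heq => hJ0 ?_
        · rw [Ideal.mem_comap, show f x = 0 from Ideal.Quotient.eq_zero_iff_mem.mpr hx]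
          exact J.zero_mem
        · rw [← Ideal.map_comap_of_surjective f hf J, ← heq, Ideal.map_quotient_self]
      exact hmax _ ⟨hJ.comap f, (Ideal.comap_mono hJP).trans hcomap.le, hyJ⟩ hlt).resolve_left hy0
  refine (tdeg_le_tdeg_quotient_add_one_of_mem_minimalPrimes (k := k) hy0 hmin).trans_eq ?_
  have : (P.map (Ideal.Quotient.mkₐ k Q)).IsPrime := this
  exact congrArg (· + 1) (AlgEquiv.tdeg_eq (DoubleQuot.quotQuotEquivQuotOfLEₐ k hQP))

universe u

/-- Inverting the nonzero elements of `R` leaves no nonzero prime, hence a field of finite type over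
Frac(R); Zariski's lemma makes it finite. -/
theorem Algebra.isAlgebraic_of_forall_under_eq_bot {R A : Type u} [CommRing R] [IsDomain R]
    [CommRing A] [IsDomain A] [Algebra R A] [FaithfulSMul R A] [Algebra.FiniteType R A]
    (h : ∀ P : Ideal A, P.IsPrime → P.under R = ⊥ → P = ⊥) : Algebra.IsAlgebraic R A := by
  let S := nonZeroDivisors R
  let K := FractionRing R
  let A' := Localization (Algebra.algebraMapSubmonoid A S)
  have hS : Algebra.algebraMapSubmonoid A S ≤ nonZeroDivisors A := by
    rintro _ ⟨r, hr, rfl⟩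
    simpa using nonZeroDivisors.ne_zero hr
  have : IsDomain A' := IsLocalization.isDomain_localization hS
  have hA'inj : Function.Injective (algebraMap A A') := IsLocalization.injective A' hS
  have hfield : IsField A' := by
    rw [← not_not (a := IsField A'), Ring.not_isField_iff_exists_prime]
    rintro ⟨m, hm0, hm⟩
    refine hm0 ?_
    have := hm
    have hdisj := ((IsLocalization.isPrime_iff_isPrime_disjoint (Algebra.algebraMapSubmonoid A S) A' m).mp hm).2
    have hbot : m.comap (algebraMap A A') = ⊥ := by
      refine h _ (hm.comap _) (eq_bot_iff.mpr fun r hr => ?_)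
      by_contra hr0
      exact Set.disjoint_left.mp hdisj ⟨r, mem_nonZeroDivisors_of_ne_zero hr0, rfl⟩ hr
    rw [← IsLocalization.map_under (Algebra.algebraMapSubmonoid A S) A' m]
    exact (congrArg _ hbot).trans Ideal.map_bot
  let _ : Field A' := hfield.toField
  have : IsLocalization (S.map (algebraMap R A)) A' :=
    inferInstanceAs (IsLocalization (Algebra.algebraMapSubmonoid A S) A')
  have : Algebra.FiniteType K A' :=
    RingHom.finiteType_localizationPreserves (algebraMap R A) S K A'
      (RingHom.finiteType_algebraMap.mpr ‹_›)
  have : Module.Finite K A' := finite_of_finite_type_of_isJacobsonRing K A'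
  have : Algebra.IsAlgebraic K A' := inferInstance
  have : Algebra.IsAlgebraic R A' := (IsFractionRing.comap_isAlgebraic_iff (A := R) (K := K)).mpr this
  exact ⟨fun a => (isAlgebraic_algebraMap_iff hA'inj).mp (Algebra.IsAlgebraic.isAlgebraic _)⟩

theorem tdeg_le_height_under_add_tdeg_quotient {k : Type*} {R T : Type u} [Field k] [CommRing R]
    [IsDomain R] [CommRing T] [IsDomain T] [Algebra k R] [Algebra k T] [Algebra R T]
    [IsScalarTower k R T] [FaithfulSMul R T] [Algebra.FiniteType k T] (P : Ideal T) [P.IsPrime] :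
    tdeg k R ≤ (P.under R).height + tdeg k (R ⧸ P.under R) := by
  have : IsNoetherianRing T := Algebra.FiniteType.isNoetherianRing k T
  cases hn : (P.under R).height with
  | top => simp
  | coe n =>
  induction n using Nat.strong_induction_on generalizing P with
  | _ n ih =>
  by_cases hp0 : P.under R = ⊥
  · refine le_add_left (tdeg_le_of_injective (Ideal.Quotient.mkₐ k (P.under R)) ?_)
    rw [injective_iff_map_eq_zero]
    intro a ha
    rw [← Ideal.mem_bot, ← hp0]
    exact Ideal.Quotient.eq_zero_iff_mem.mp ha
  obtain ⟨y, hyP, hy0⟩ := Submodule.exists_mem_ne_zero_of_ne_bot hp0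
  -- Maximality of P' among primes with this contraction is what makes T/P' algebraic over R/(P ∩
  -- R).
  obtain ⟨P', ⟨hP', hP'P⟩, hmax⟩ := set_has_maximal_iff_noetherian.mpr ‹IsNoetherianRing T›
    {J : Ideal T | J.IsPrime ∧ J.under R = P.under R} ⟨P, ‹_›, rfl⟩
  have : Ideal.LiesOver P' (P.under R) := ⟨hP'P.symm⟩
  have : Algebra.FiniteType (R ⧸ P.under R) (T ⧸ P') :=
    Algebra.FiniteType.of_restrictScalars_finiteType k _ _
  have : Algebra.IsAlgebraic (R ⧸ P.under R) (T ⧸ P') := by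
    refine Algebra.isAlgebraic_of_forall_under_eq_bot fun J hJ hJ0 => ?_
    have hP'J : P' ≤ J.comap (Ideal.Quotient.mk P') := fun x hx => by
      rw [Ideal.mem_comap, Ideal.Quotient.eq_zero_iff_mem.mpr hx]
      exact J.zero_mem
    have hJR : (J.comap (Ideal.Quotient.mk P')).under R = P.under R := by
      ext r
      rw [← Ideal.Quotient.eq_zero_iff_mem (I := P.under R), ← Ideal.mem_bot, ← hJ0]
      rfl
    have heq := hP'J.eq_of_not_lt (hmax _ ⟨hJ.comap _, hJR⟩)
    rw [← Ideal.map_comap_of_surjective _ Ideal.Quotient.mk_surjective J, ← heq,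
      Ideal.map_quotient_self]
  have htd : tdeg k (T ⧸ P') = tdeg k (R ⧸ P.under R) := tdeg_eq_of_isAlgebraic
  -- Since y comes from R, avoiding it forces the contraction, and hence its height, to drop.
  obtain ⟨Q, hQ, hQP', hyQ, hQtd⟩ := exists_isPrime_le_notMem_tdeg_quotient_le (k := k)
    (y := algebraMap R T y) (by simpa using hy0) P' (hP'P.ge hyP)
  have hlt : Q.under R < P.under R := by
    refine lt_of_le_of_ne ((Ideal.comap_mono hQP').trans_eq hP'P) fun h => hyQ (h.ge hyP)
  have hht := Ideal.height_add_one_le_of_lt_of_isPrime hlt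
  rw [hn] at hht
  cases hm : (Q.under R).height with
  | top => simp [hm] at hht
  | coe m =>
  rw [hm] at hht
  have hmn : m + 1 ≤ n := by exact_mod_cast hht
  have hle : tdeg k (R ⧸ Q.under R) ≤ tdeg k (T ⧸ Q) :=
    tdeg_le_of_injective (IsScalarTower.toAlgHom k (R ⧸ Q.under R) (T ⧸ Q))
      (FaithfulSMul.algebraMap_injective _ _)
  calc tdeg k R ≤ m + tdeg k (R ⧸ Q.under R) := ih m (by omega) Q hm
    _ ≤ m + (tdeg k (R ⧸ P.under R) + 1) := by
      gcongr
      exact (hle.trans hQtd).trans_eq (by rw [htd])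
    _ = (m + 1 : ℕ) + tdeg k (R ⧸ P.under R) := by push_cast; ring
    _ ≤ n + tdeg k (R ⧸ P.under R) := by gcongr

end LowerBound

/-! ### Krull dimension versus valuative dimension. -/

section ValuativeDimension

theorem ringKrullDim_valuationSubring {K : Type*} [Field K] (V : ValuationSubring K) :
    ringKrullDim V = Order.coheight V := by
  rw [Order.coheight_eq_krullDim_Ici, ringKrullDim, ← Order.krullDim_orderDual]
  exact Order.krullDim_eq_of_orderIso V.primeSpectrumOrderEquiv

variable {A K : Type*} [CommRing A] [Field K] [Algebra A K]

/-- With m the maximal ideal of V, let B = A + m and I = q + m. Then I is prime with trace q on A,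
and a valuation ring W dominating B at I is centered on q. As m consists of nonunits of W, W ≤ V;
the centers differ, so W ≠ V. -/
theorem exists_valuationSubring_lt_of_lt {V : ValuationSubring K}
    (hV : ∀ a, algebraMap A K a ∈ V) {p q : Ideal A} [q.IsPrime] (hpq : p < q)
    (hp : ∀ a, a ∈ p ↔ algebraMap A K a ∈ V.nonunits) :
    ∃ W < V, (∀ a, algebraMap A K a ∈ W) ∧ ∀ a, a ∈ q ↔ algebraMap A K a ∈ W.nonunits := by
  have hmul {x y : K} (hx : x ∈ V) (hy : y ∈ V.nonunits) : x * y ∈ V.nonunits := by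
    rw [V.mem_nonunits_iff] at hy ⊢
    rw [map_mul]
    exact mul_lt_one_of_nonneg_of_lt_one_right ((V.valuation_le_one_iff x).mpr hx) zero_le hy
  have hmulsub {x y : K} {a b : A} (hx : x - algebraMap A K a ∈ V.nonunits)
      (hy : y - algebraMap A K b ∈ V.nonunits) :
      x * y - algebraMap A K (a * b) ∈ V.nonunits := by
    have hyV : y ∈ V := by
      have := V.add_mem _ _ (V.nonunits_subset hy) (hV b)
      rwa [sub_add_cancel] at this
    have h := add_mem (hmul hyV hx) (hmul (hV a) hy)
    rw [map_mul]
    convert h using 1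
    ring
  have haddsub {x y : K} {a b : A} (hx : x - algebraMap A K a ∈ V.nonunits)
      (hy : y - algebraMap A K b ∈ V.nonunits) :
      x + y - algebraMap A K (a + b) ∈ V.nonunits := by
    rw [map_add, add_sub_add_comm]
    exact add_mem hx hy
  have hself (a : A) : algebraMap A K a - algebraMap A K a ∈ V.nonunits := by
    rw [sub_self]
    exact zero_mem _
  let B : Subring K :=
    { carrier := {x | ∃ a, x - algebraMap A K a ∈ V.nonunits}
      mul_mem' := fun ⟨a, ha⟩ ⟨b, hb⟩ => ⟨a * b, hmulsub ha hb⟩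
      one_mem' := ⟨1, by simp⟩
      add_mem' := fun ⟨a, ha⟩ ⟨b, hb⟩ => ⟨a + b, haddsub ha hb⟩
      zero_mem' := ⟨0, by simp⟩
      neg_mem' := fun {x} ⟨a, ha⟩ => ⟨-a, by
        rw [map_neg, ← neg_add', ← sub_eq_add_neg]
        exact neg_mem ha⟩ }
  let I : Ideal B :=
    { carrier := {x | ∃ a ∈ q, (x : K) - algebraMap A K a ∈ V.nonunits}
      add_mem' := fun ⟨a, haq, ha⟩ ⟨b, hbq, hb⟩ => ⟨a + b, q.add_mem haq hbq, haddsub ha hb⟩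
      zero_mem' := ⟨0, q.zero_mem, by simp⟩
      smul_mem' := fun ⟨x, b, hb⟩ y ⟨a, haq, ha⟩ => ⟨b * a, q.mul_mem_left b haq, hmulsub hb ha⟩ }
  have hI {x : B} {a : A} (ha : (x : K) - algebraMap A K a ∈ V.nonunits) : x ∈ I ↔ a ∈ q := by
    refine ⟨fun ⟨b, hbq, hb⟩ => ?_, fun haq => ⟨a, haq, ha⟩⟩
    have h : a - b ∈ p := by
      rw [hp, map_sub]
      have := sub_mem hb ha
      rwa [sub_sub_sub_cancel_left] at this
    have := q.add_mem (hpq.le h) hbq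
    rwa [sub_add_cancel] at this
  have hIprime : I.IsPrime := by
    refine ⟨fun htop => ?_, ?_⟩
    · have h1 : (1 : B) ∈ I := htop ▸ Submodule.mem_top
      exact (Ideal.ne_top_iff_one q).mp ‹q.IsPrime›.ne_top
        ((hI (a := 1) (by simp)).mp h1)
    · rintro ⟨x, a, ha⟩ ⟨y, b, hb⟩ hxy
      rw [hI (hmulsub ha hb)] at hxy
      rw [hI ha, hI hb]
      exact ‹q.IsPrime›.mem_or_mem hxy
  obtain ⟨W, hBW, hloc⟩ := (LocalSubring.ofPrime B I).exists_le_valuationSubring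
  have hBW' {x : K} (hx : x ∈ B) : x ∈ W := hBW (LocalSubring.le_ofPrime B I hx)
  have hW (x : B) : x ∈ I ↔ (x : K) ∈ W.nonunits := by
    rw [← IsLocalization.AtPrime.to_map_mem_maximal_iff (LocalSubring.ofPrime B I).toSubring I x,
      IsLocalRing.mem_maximalIdeal, mem_nonunits_iff, ← isUnit_map_iff (Subring.inclusion hBW),
      ← mem_nonunits_iff, ← IsLocalRing.mem_maximalIdeal]
    exact (W.coe_mem_nonunits_iff (a := ⟨x, hBW' x.2⟩)).symm
  have hA (a : A) : algebraMap A K a ∈ B := ⟨a, hself a⟩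
  have hqW (a : A) : a ∈ q ↔ algebraMap A K a ∈ W.nonunits := by
    rw [← hW ⟨_, hA a⟩, hI (hself a)]
  have hVW : V.nonunits ≤ W.nonunits := fun x hx => by
    have hxB : x - algebraMap A K 0 ∈ V.nonunits := by simpa using hx
    exact (hW ⟨x, 0, hxB⟩).mp ⟨0, q.zero_mem, hxB⟩
  refine ⟨W, lt_of_le_of_ne (ValuationSubring.nonunits_le_nonunits.mp hVW) ?_,
    fun a => hBW' (hA a), hqW⟩
  rintro rfl
  exact hpq.ne (Ideal.ext fun a => (hp a).trans (hqW a).symm)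

theorem exists_valuationSubring_nonunits_of_isPrime (hinj : Function.Injective (algebraMap A K))
    (q : Ideal A) [q.IsPrime] :
    ∃ V : ValuationSubring K, (∀ a, algebraMap A K a ∈ V) ∧
      ∀ a, a ∈ q ↔ algebraMap A K a ∈ V.nonunits := by
  by_cases hq : q = ⊥
  · refine ⟨⊤, fun a => ValuationSubring.mem_top _, fun a => ?_⟩
    rw [ValuationSubring.mem_nonunits_iff_or, hq, Ideal.mem_bot]
    simp [ValuationSubring.mem_top, map_eq_zero_iff _ hinj]
  · obtain ⟨W, -, hW⟩ := exists_valuationSubring_lt_of_lt (V := (⊤ : ValuationSubring K))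
      (fun a => ValuationSubring.mem_top _) (bot_lt_iff_ne_bot.mpr hq) (fun a => by
        rw [ValuationSubring.mem_nonunits_iff_or, Ideal.mem_bot]
        simp [ValuationSubring.mem_top, map_eq_zero_iff _ hinj])
    exact ⟨W, hW⟩

/-- Each step up a chain of primes strictly shrinks the valuation ring. Coheight counts its
overrings, which correspond to its primes in reverse order. -/
theorem exists_valuationSubring_le_coheight (hinj : Function.Injective (algebraMap A K)) (n : ℕ)
    (q : Ideal A) [q.IsPrime] (hn : n ≤ q.height) :
    ∃ V : ValuationSubring K, (∀ a, algebraMap A K a ∈ V) ∧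
      (∀ a, a ∈ q ↔ algebraMap A K a ∈ V.nonunits) ∧ n ≤ Order.coheight V := by
  induction n generalizing q with
  | zero =>
    obtain ⟨V, h1, h2⟩ := exists_valuationSubring_nonunits_of_isPrime hinj q
    exact ⟨V, h1, h2, zero_le⟩
  | succ n ih =>
    rw [show q = (⟨q, inferInstance⟩ : PrimeSpectrum A).asIdeal from rfl,
      PrimeSpectrum.height_eq_orderHeight] at hn
    obtain ⟨s, hs, hlen⟩ := Order.exists_series_of_le_height _ hn
    let p := s.eraseLast.last
    have hpq : p.asIdeal < q := by
      have h := s.eraseLast_last_rel_last (by omega)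
      rw [hs] at h
      exact h
    have hnp : n ≤ p.asIdeal.height := by
      rw [PrimeSpectrum.height_eq_orderHeight]
      refine le_trans ?_ Order.length_le_height_last
      simp [hlen]
    obtain ⟨V, h1, h2, h3⟩ := ih p.asIdeal hnp
    obtain ⟨W, hWV, h4, h5⟩ := exists_valuationSubring_lt_of_lt h1 hpq h2
    refine ⟨W, h4, h5, ?_⟩
    push_cast
    exact (add_le_add_left h3 1).trans (Order.coheight_add_one_le hWV)

theorem ringKrullDim_le_valuativeDim (A : Type*) [CommRing A] [IsDomain A] :
    ringKrullDim A ≤ valuativeDim A := by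
  refine (ringKrullDim_le_iff_height_le _).mpr fun p hp => ?_
  have key (n : ℕ) (hn : n ≤ p.height) : (n : WithBot ℕ∞) ≤ valuativeDim A := by
    obtain ⟨V, hV, -, hVn⟩ := exists_valuationSubring_le_coheight
      (IsFractionRing.injective A (FractionRing A)) n p hn
    refine le_trans ?_ (le_iSup₂ (f := fun (V : ValuationSubring (FractionRing A))
      (_ : V ∈ valuationOverrings A) => ringKrullDim V) V hV)
    rw [ringKrullDim_valuationSubring]
    exact WithBot.coe_le_coe.mpr hVn
  cases h : valuativeDim A with
  | bot => exact absurd (h ▸ key 0 zero_le) (by simp)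
  | coe d =>
    refine WithBot.coe_le_coe.mpr (ENat.forall_natCast_le_iff_le.mp fun n hn => ?_)
    exact WithBot.coe_le_coe.mp (h ▸ key n hn)

end ValuativeDimension

/-! ### Subalgebras of affine domains and the final assembly. -/

section AffineDomain

universe u

theorem height_under_add_tdeg_quotient_eq {k : Type*} {R T : Type u} [Field k] [CommRing R] [IsDomain R] [CommRing T]
    [IsDomain T] [Algebra k R] [Algebra k T] [Algebra R T] [IsScalarTower k R T] [FaithfulSMul R T]
    [Algebra.FiniteType k T]
    (P : Ideal T) [P.IsPrime] :
    (P.under R).height + tdeg k (R ⧸ P.under R) = tdeg k R :=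
  le_antisymm (height_add_tdeg_quotient_le _) (tdeg_le_height_under_add_tdeg_quotient P)

theorem tdeg_quotient_under_eq_zero (k : Type*) {R T : Type u} [Field k] [CommRing R] [CommRing T]
    [Algebra k R] [Algebra k T] [Algebra R T] [IsScalarTower k R T] [Algebra.FiniteType k T]
    (P : Ideal T) [P.IsMaximal] :
    tdeg k (R ⧸ P.under R) = 0 := by
  let _ : Field (T ⧸ P) := Ideal.Quotient.field P
  have : Module.Finite k (T ⧸ P) := finite_of_finite_type_of_isJacobsonRing k (T ⧸ P)
  have h0 : tdeg k (T ⧸ P) = 0 := by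
    rw [tdeg_eq_toENat_trdeg, trdeg_eq_zero, map_zero]
  rw [← nonpos_iff_eq_zero, ← h0]
  exact tdeg_le_of_injective (IsScalarTower.toAlgHom k (R ⧸ P.under R) (T ⧸ P))
    (FaithfulSMul.algebraMap_injective _ _)

theorem height_under_eq_tdeg_of_isMaximal {k : Type*} {R T : Type u} [Field k] [CommRing R] [IsDomain R] [CommRing T]
    [IsDomain T] [Algebra k R] [Algebra k T] [Algebra R T] [IsScalarTower k R T] [FaithfulSMul R T]
    [Algebra.FiniteType k T]
    (P : Ideal T) [P.IsMaximal] :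
    (P.under R).height = tdeg k R := by
  rw [← height_under_add_tdeg_quotient_eq (k := k) P, tdeg_quotient_under_eq_zero k P, add_zero]

theorem ringKrullDim_eq_tdeg (k : Type*) (R T : Type u) [Field k] [CommRing R] [IsDomain R] [CommRing T]
    [IsDomain T] [Algebra k R] [Algebra k T] [Algebra R T] [IsScalarTower k R T] [FaithfulSMul R T]
    [Algebra.FiniteType k T] :
    ringKrullDim R = (tdeg k R : WithBot ℕ∞) := by
  obtain ⟨P, hP⟩ := Ideal.exists_maximal T
  refine le_antisymm ringKrullDim_le_tdeg ?_
  rw [← height_under_eq_tdeg_of_isMaximal (k := k) (R := R) P]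
  exact Ideal.height_le_ringKrullDim_of_ne_top Ideal.IsPrime.ne_top'

theorem tdeg_mvPolynomial {k R : Type*} [Field k] [CommRing R] [IsDomain R] [Algebra k R] (n : ℕ) :
    tdeg k (MvPolynomial (Fin n) R) = n + tdeg k R := by
  rw [tdeg_eq_toENat_trdeg, tdeg_eq_toENat_trdeg, 
    ← trdeg_add_eq (R := k) (S := R) (A := MvPolynomial (Fin n) R),
    MvPolynomial.trdeg_of_isDomain, map_add, add_comm]
  simp

theorem isJaffard_of_faithfulSMul (k : Type*) (R T : Type u) [Field k] [CommRing R] [IsDomain R] [CommRing T]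
    [IsDomain T] [Algebra k R] [Algebra k T] [Algebra R T] [IsScalarTower k R T] [FaithfulSMul R T]
    [Algebra.FiniteType k T] :
    IsJaffard R := by
  have hfin : tdeg k R ≠ ⊤ := ne_top_of_le_ne_top tdeg_ne_top_of_finiteType
    (tdeg_le_of_injective (IsScalarTower.toAlgHom k R T) (FaithfulSMul.algebraMap_injective R T))
  refine ⟨?_, fun n _ => ?_⟩
  · rw [finiteRingKrullDim_iff_ne_bot_and_top, ringKrullDim_eq_tdeg k R T]
    exact ⟨WithBot.coe_ne_bot, fun h => hfin (WithBot.coe_injective h)⟩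
  -- The dimension formula applies again to R[X₁, …, Xₙ] inside T[X₁, …, Xₙ].
  · let _ : Algebra (MvPolynomial (Fin n) R) (MvPolynomial (Fin n) T) :=
      (MvPolynomial.map (algebraMap R T)).toAlgebra
    have : FaithfulSMul (MvPolynomial (Fin n) R) (MvPolynomial (Fin n) T) := by
      rw [faithfulSMul_iff_algebraMap_injective]
      exact MvPolynomial.map_injective _ (FaithfulSMul.algebraMap_injective R T)
    have : IsScalarTower k (MvPolynomial (Fin n) R) (MvPolynomial (Fin n) T) :=
      .of_algebraMap_eq fun x => by
        simp [RingHom.algebraMap_toAlgebra, MvPolynomial.algebraMap_apply,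
          ← IsScalarTower.algebraMap_apply k R T]
    rw [ringKrullDim_eq_tdeg k (MvPolynomial (Fin n) R) (MvPolynomial (Fin n) T),
      ringKrullDim_eq_tdeg k R T, tdeg_mvPolynomial]
    rfl

theorem valuativeDim_le_tdeg {k R : Type*} [Field k] [CommRing R] [IsDomain R] [Algebra k R] :
    valuativeDim R ≤ (tdeg k R : WithBot ℕ∞) := by
  refine iSup₂_le fun V hV => ?_
  let _ : Algebra k V := ((algebraMap R (FractionRing R)).codRestrict V.toSubring hV).comp
    (algebraMap k R) |>.toAlgebra
  let f : V →ₐ[k] FractionRing R := { V.subtype with commutes' := fun x => rfl }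
  refine (ringKrullDim_le_tdeg (k := k)).trans (WithBot.coe_le_coe.mpr ?_)
  exact (tdeg_le_of_injective f V.subtype_injective).trans_eq tdeg_eq_toENat_trdeg

end AffineDomain

theorem corollary3p3 {k T : Type*} [Field k] [CommRing T] [IsDomain T] [Algebra k T]
    [Algebra.FiniteType k T] (R : Subalgebra k T) :
    (ringKrullDim R = (tdeg k R : WithBot ℕ∞) ∧ IsJaffard R ∧
      ringKrullDim R = valuativeDim R) ∧
    (∀ (P : Ideal T) [P.IsPrime],
      ringKrullDim R = (((P.under R).height + tdeg k (R ⧸ P.under R) : ℕ∞) : WithBot ℕ∞)) ∧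
    (∀ M : Ideal R, M.IsMaximal → SurvivesIn M T →
      ringKrullDim R = (M.height : WithBot ℕ∞)) := by
  have hdim := ringKrullDim_eq_tdeg k R T
  refine ⟨⟨hdim, isJaffard_of_faithfulSMul k R T, ?_⟩, fun P _ => ?_, fun M hM hMT => ?_⟩
  · exact le_antisymm (ringKrullDim_le_valuativeDim R) (hdim ▸ valuativeDim_le_tdeg)
  · rw [height_under_add_tdeg_quotient_eq, hdim]
  · obtain ⟨P, hP, hMP⟩ := Ideal.exists_le_maximal _ hMT
    have hMeq : M = P.under R := hM.eq_of_le Ideal.IsPrime.ne_top' (Ideal.map_le_iff_le_comap.mp hMP)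
    rw [hdim, hMeq, height_under_eq_tdeg_of_isMaximal (k := k)]
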